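/- \textbf{Setting.} A 1-identification instance with $K\ge 1$ arms and known threshold $\mu_0\in\mathbb R$ is a vector $\nu=(\nu_a)_{a\in[K]}$ of probability distributions on $\mathbb R$ with means $m_a$, such that for $R\sim\nu_a$ the noise $R-m_a$ is $1$-sub-Gaussian. It is positive if $\max_a m_a>\mu_0$ and negative if $\max_a m_a<\mu_0$. The set $i^*(\nu)$ of correct answers is $\{a: m_a\ge\mu_0\}$ for a positive instance and $\{\mathsf{None}\}$ for a negative one. A pulling strategy $\mathsf{alg}=(\pi,\tau,\hat a)$ consists of a sampling rule choosing $A_t=\pi_t(H(t-1))\in[K]$ as a measurable function of the history $H(t-1)=((A_s,X_s))_{s\le t-1}$, where the reward $X_t$ given the past and $A_t$ has law $\nu_{A_t}$; a stopping time $\tau\in\{0,1,2,\dots\}\cup\{\infty\}$ with respect to $(\sigma(H(t)))_t$; and a recommendation $\hat a\in[K]\cup\{\mathsf{None}\}$ which is a function of $H(\tau)$. For $\delta\in(0,1)$ the strategy is $\delta$-PAC (for the threshold $\mu_0$) if $\Pr_\nu(\tau<\infty,\ \hat a\in i^*(\nu))>1-\delta$ for every positive or negative instance $\nu$. \textbf{Theorem.}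 For every $\delta_0\in(0,\tfrac12)$ there is a constant $c>0$, depending only on $\delta_0$, such that the following holds. Let $K\ge1$, let $\{\mu_a\}_{a=0}^K\in[0,1]^{K+1}$ with $\mu_1\ge\mu_2\ge\dots\ge\mu_K$ and $\mu_1>\mu_0$, and put $\Delta_{0,1}=|\mu_0-\mu_1|$. Let $\nu$ be an instance with unit-variance Gaussian rewards whose mean vector is a permutation of $(\mu_1,\dots,\mu_K)$, and with threshold $\mu_0$. Then for every $\delta\in(0,\delta_0]$ and every $\delta$-PAC strategy $\mathsf{alg}$, $$\mathbb E_{\nu,\mathsf{alg}}[\tau]\ \ge\ c\,\frac{\log(1/\delta)}{\Delta_{0,1}^2},$$ where $\mathbb E_{\nu,\mathsf{alg}}[\tau]$ may be $+\infty$. -/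

import Mathlib

open MeasureTheory ProbabilityTheory

namespace OneIdentification

/-- An infinite interaction sequence: `ω s` is the pair (arm pulled, reward observed) of round
`s + 1`, with `K` arms. -/
abbrev Trajectory (K : ℕ) : Type := ℕ → Fin K × ℝ

/-- The history `H(t)`: the first `t` pairs (arm pulled, reward observed). -/
def history {K : ℕ} (t : ℕ) (ω : Trajectory K) : Fin t → Fin K × ℝ := fun s => ω s

theorem measurable_history {K : ℕ} (t : ℕ) : Measurable (history (K := K) t) :=
  measurable_pi_lambda _ fun s => measurable_pi_apply (s : ℕ)

/-- The filtration `t ↦ σ(H(t))`. -/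
def historyFiltration (K : ℕ) :
    Filtration ℕ (inferInstance : MeasurableSpace (Trajectory K)) where
  seq t := MeasurableSpace.comap (history t) inferInstance
  mono' := by
    intro s t hst
    have h : history (K := K) s =
        (fun (x : Fin t → Fin K × ℝ) (i : Fin s) => x (Fin.castLE hst i)) ∘ history t := rfl
    have hm : Measurable
        (fun (x : Fin t → Fin K × ℝ) (i : Fin s) => x (Fin.castLE hst i)) :=
      measurable_pi_lambda _ fun i => measurable_pi_apply _
    change MeasurableSpace.comap (history s) _ ≤ MeasurableSpace.comap (history t) _
    rw [h, ← MeasurableSpace.comap_comp]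
    exact MeasurableSpace.comap_mono hm.comap_le
  le' t := (measurable_history t).comap_le

/-- A pulling strategy `(π, τ, â)` for `K` arms. The answer `none` stands for "no qualified arm". -/
structure Strategy (K : ℕ) where
  /-- sampling rule: `sample t` maps the history of the first `t` rounds to the arm pulled in
  round `t + 1` -/
  sample : (t : ℕ) → (Fin t → Fin K × ℝ) → Fin K
  measurable_sample : ∀ t, Measurable (sample t)
  /-- stopping time, where `⊤` means that the strategy never stops -/
  τ : Trajectory K → ℕ∞
  isStoppingTime : IsStoppingTime (historyFiltration K) τ
  /-- recommendation rule; its value where `τ = ⊤` is meaningless -/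
  recommend : Trajectory K → Option (Fin K)
  /-- on `τ = t`, the recommendation is a function of the history `H(t)` -/
  measurableSet_recommend : ∀ (t : ℕ) (r : Option (Fin K)),
    MeasurableSet[historyFiltration K t] {ω | τ ω = t ∧ recommend ω = r}

/-- The law of a pair (arm, reward) given that arm `a` is pulled: the arm is `a` and the reward
has law `ν a`. -/
noncomputable def pullKernel {K : ℕ} (ν : Fin K → Measure ℝ) : Kernel (Fin K) (Fin K × ℝ) :=
  Kernel.ofFunOfCountable fun a => (ν a).map (Prod.mk a)

instance {K : ℕ} (ν : Fin K → Measure ℝ) [∀ a, IsProbabilityMeasure (ν a)] :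
    IsMarkovKernel (pullKernel ν) :=
  ⟨fun _ => Measure.isProbabilityMeasure_map measurable_prodMk_left.aemeasurable⟩

/-- The pairs with indices `0, …, n`, seen as the history of the first `n + 1` rounds. -/
def toHistory {K : ℕ} (n : ℕ) (h : (i : Finset.Iic n) → Fin K × ℝ) : Fin (n + 1) → Fin K × ℝ :=
  fun s => h ⟨s, Finset.mem_Iic.2 (Nat.lt_succ_iff.1 s.isLt)⟩

theorem measurable_toHistory {K : ℕ} (n : ℕ) : Measurable (toHistory (K := K) n) :=
  measurable_pi_lambda _ fun _ => measurable_pi_apply _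

/-- The conditional law of the pair with index `n + 1` given the pairs with indices `0, …, n`. -/
noncomputable def stepKernel {K : ℕ} (ν : Fin K → Measure ℝ) (alg : Strategy K) (n : ℕ) :
    Kernel ((i : Finset.Iic n) → Fin K × ℝ) (Fin K × ℝ) :=
  (pullKernel ν).comap (fun h => alg.sample (n + 1) (toHistory n h))
    ((alg.measurable_sample (n + 1)).comp (measurable_toHistory n))

instance {K : ℕ} (ν : Fin K → Measure ℝ) [∀ a, IsProbabilityMeasure (ν a)]
    (alg : Strategy K) (n : ℕ) : IsMarkovKernel (stepKernel ν alg n) := by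
  unfold stepKernel; infer_instance

/-- The law of the interaction of the strategy `alg` with the arms `ν`: in every round the next
arm is given by the sampling rule, and given the past its reward is drawn from the law of that
arm. (The sequence is continued after `τ`, which affects neither `τ` nor the recommendation.) -/
noncomputable def law {K : ℕ} (ν : Fin K → Measure ℝ) [∀ a, IsProbabilityMeasure (ν a)]
    (alg : Strategy K) : Measure (Trajectory K) :=
  Kernel.trajMeasure (X := fun _ => Fin K × ℝ) (pullKernel ν (alg.sample 0 Fin.elim0))
    (stepKernel ν alg)

/-- The mean reward of arm `a`. -/
noncomputable def mean {K : ℕ} (ν : Fin K → Measure ℝ) (a : Fin K) : ℝ := ∫ x, x ∂(ν a)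

/-- The centred reward of every arm is `1`-sub-Gaussian. -/
def IsSubGaussianInstance {K : ℕ} (ν : Fin K → Measure ℝ) : Prop :=
  ∀ a, HasSubgaussianMGF (fun x => x - mean ν a) 1 (ν a)

/-- Positive instance: the largest mean reward exceeds the threshold. -/
def IsPositive {K : ℕ} (μ₀ : ℝ) (ν : Fin K → Measure ℝ) : Prop := ∃ a, μ₀ < mean ν a

/-- Negative instance: the largest mean reward is below the threshold. -/
def IsNegative {K : ℕ} (μ₀ : ℝ) (ν : Fin K → Measure ℝ) : Prop := ∀ a, mean ν a < μ₀

/-- The set `i*(ν)` of correct answers: the qualified arms if `ν` is positive, and only `none`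
if `ν` is negative. -/
def correctAnswers {K : ℕ} (μ₀ : ℝ) (ν : Fin K → Measure ℝ) : Set (Option (Fin K)) :=
  {r | (IsPositive μ₀ ν ∧ ∃ a, r = some a ∧ μ₀ ≤ mean ν a) ∨ (IsNegative μ₀ ν ∧ r = none)}

/-- The strategy is `δ`-PAC for the threshold `μ₀`: on every `1`-sub-Gaussian positive or negative
instance, with probability more than `1 - δ` it stops and recommends a correct answer. -/
def IsPAC {K : ℕ} (μ₀ δ : ℝ) (alg : Strategy K) : Prop :=
  ∀ (ν : Fin K → Measure ℝ) [∀ a, IsProbabilityMeasure (ν a)],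
    IsSubGaussianInstance ν → (IsPositive μ₀ ν ∨ IsNegative μ₀ ν) →
      1 - δ < (law ν alg).real {ω | alg.τ ω ≠ ⊤ ∧ alg.recommend ω ∈ correctAnswers μ₀ ν}

/-- The expected stopping time `E[τ]`, which may be infinite. -/
noncomputable def expectedTime {K : ℕ} (ν : Fin K → Measure ℝ)
    [∀ a, IsProbabilityMeasure (ν a)] (alg : Strategy K) : ENNReal :=
  ∫⁻ ω, (alg.τ ω : ENNReal) ∂(law ν alg)

/-- The instance whose arms have unit-variance Gaussian rewards with means `m`. -/
noncomputable def gaussianInstance {K : ℕ} (m : Fin K → ℝ) : Fin K → Measure ℝ :=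
  fun a => gaussianReal (m a) 1

instance {K : ℕ} (m : Fin K → ℝ) (a : Fin K) : IsProbabilityMeasure (gaussianInstance m a) := by
  unfold gaussianInstance; infer_instance

end OneIdentification

/-! Lowering every mean by `d = 2 * (μ 0 - μ₀)` makes the instance negative. Let `B` be the event of
stopping by a fixed time `n` with an answer correct for the original instance. On the shifted
instance these answers are all wrong, so `B` has probability at most `δ` there. Hölder's inequality
for the likelihood ratio of the `n`-round histories, with exponents `1 / κ` and `1 / (1 - κ)`,
bounds the original probability of `B` by `exp (n * (1 / κ - 1) * d ^ 2 / 2) * δ ^ (1 - κ)`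
(`law_gaussianInstance_le`). If `n` is a small multiple of `log (1 / δ) / d ^ 2`, this is at most `δ
^ (1 - 2 * κ)`, and `κ` is tuned to `δ₀` so that this is at most `1 / 2`. Hence `τ > n` has
probability at least `1 / 2 - δ₀`, and Markov's inequality concludes. Working up to a fixed time
needs no integrability of `τ`. -/

namespace OneIdentification

/-! ### Change of measure for one Gaussian reward -/

theorem gaussianReal_eq_withDensity (m m' : ℝ) :
    gaussianReal m 1 = (gaussianReal m' 1).withDensity
      fun x => ENNReal.ofReal (Real.exp ((m - m') * x + (m' ^ 2 - m ^ 2) / 2)) := by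
  rw [gaussianReal_of_var_ne_zero m one_ne_zero, gaussianReal_of_var_ne_zero m' one_ne_zero,
    ← withDensity_mul _ (measurable_gaussianPDF _ _) (by fun_prop)]
  congr 1
  ext x
  simp only [Pi.mul_apply, gaussianPDF, gaussianPDFReal]
  rw [← ENNReal.ofReal_mul (by positivity), mul_assoc _ (Real.exp _) (Real.exp _), ← Real.exp_add]
  congr 3
  simp only [NNReal.coe_one]
  ring

/-- Hölder applied to density times `f`; the constant is the `L^p` norm of the likelihood ratio,
read off the Gaussian moment generating function. -/
theorem lintegral_gaussianReal_le_rpow {p q : ℝ} (hpq : p.HolderConjugate q) (m m' : ℝ)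
    {f : ℝ → ENNReal} (hf : Measurable f) :
    ∫⁻ x, f x ∂(gaussianReal m 1) ≤ ENNReal.ofReal (Real.exp ((p - 1) * (m - m') ^ 2 / 2)) *
      (∫⁻ x, f x ^ q ∂(gaussianReal m' 1)) ^ (1 / q) := by
  have hp : p ≠ 0 := hpq.ne_zero
  rw [gaussianReal_eq_withDensity m m', lintegral_withDensity_eq_lintegral_mul _ (by fun_prop) hf]
  refine (ENNReal.lintegral_mul_le_Lp_mul_Lq _ hpq (by fun_prop) hf.aemeasurable).trans_eq ?_
  congr 1
  have h1 : ∀ x : ℝ,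
      ENNReal.ofReal (Real.exp ((m - m') * x + (m' ^ 2 - m ^ 2) / 2)) ^ p =
        ENNReal.ofReal (Real.exp ((p * (m - m')) * x) *
          Real.exp (p * ((m' ^ 2 - m ^ 2) / 2))) := fun x => by
    rw [ENNReal.ofReal_rpow_of_pos (Real.exp_pos _), ← Real.exp_mul, ← Real.exp_add]
    congr 2
    ring
  have h2 : ∫ x, Real.exp ((p * (m - m')) * x) ∂(gaussianReal m' 1) =
      Real.exp (m' * (p * (m - m')) + (p * (m - m')) ^ 2 / 2) := by
    simpa [mgf] using congrFun (mgf_fun_id_gaussianReal (μ := m') (v := 1)) (p * (m - m'))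
  simp_rw [h1]
  rw [← ofReal_integral_eq_lintegral_ofReal
      ((integrable_exp_mul_gaussianReal _).mul_const _) (ae_of_all _ fun x => by positivity),
    integral_mul_const, h2, ← Real.exp_add, ENNReal.ofReal_rpow_of_pos (Real.exp_pos _),
    ← Real.exp_mul]
  congr 2
  field_simp
  ring

theorem isSubGaussianInstance_gaussianInstance {K : ℕ} (m : Fin K → ℝ) :
    IsSubGaussianInstance (gaussianInstance m) := by
  intro a
  have hmap : (gaussianReal (m a) 1).map (fun x => x - m a) = gaussianReal 0 1 := by
    rw [gaussianReal_map_sub_const, sub_self]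
  simp only [mean, gaussianInstance, integral_id_gaussianReal]
  refine ⟨fun t => ?_, fun t => ?_⟩
  · simp_rw [mul_sub, sub_eq_add_neg, Real.exp_add]
    exact (integrable_exp_mul_gaussianReal t).mul_const _
  · rw [mgf_gaussianReal hmap]
    simp

theorem mean_gaussianInstance {K : ℕ} (m : Fin K → ℝ) (a : Fin K) :
    mean (gaussianInstance m) a = m a := by
  simp [mean, gaussianInstance]

/-! ### Change of measure for histories -/

theorem lintegral_pullKernel {K : ℕ} (ν : Fin K → Measure ℝ) (a : Fin K)
    {f : Fin K × ℝ → ENNReal} (hf : Measurable f) :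
    ∫⁻ y, f y ∂(pullKernel ν a) = ∫⁻ x, f (a, x) ∂(ν a) := by
  change ∫⁻ y, f y ∂((ν a).map (Prod.mk a)) = _
  rw [lintegral_map hf measurable_prodMk_left]

instance {K : ℕ} (ν : Fin K → Measure ℝ) [∀ a, IsProbabilityMeasure (ν a)] (alg : Strategy K) :
    IsProbabilityMeasure (law ν alg) := by
  unfold law; infer_instance

theorem law_map_zero {K : ℕ} (ν : Fin K → Measure ℝ) [∀ a, IsProbabilityMeasure (ν a)]
    (alg : Strategy K) :
    (law ν alg).map (fun ω => ω 0) = pullKernel ν (alg.sample 0 Fin.elim0) := by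
  have h : (fun ω : Trajectory K => ω 0) =
      (fun x : (i : Finset.Iic 0) → Fin K × ℝ => x ⟨0, by simp⟩) ∘
        Preorder.frestrictLe (π := fun _ => Fin K × ℝ) 0 := rfl
  have hm : Measurable (fun x : (i : Finset.Iic 0) → Fin K × ℝ => x ⟨0, by simp⟩) :=
    measurable_pi_apply _
  rw [h, ← Measure.map_map hm (by fun_prop), law, Kernel.trajMeasure,
    Measure.map_comp _ _ (by fun_prop), Kernel.traj_map_frestrictLe, Kernel.partialTraj_self,
    Measure.id_comp, Measure.map_map hm (by fun_prop)]
  exact Measure.map_id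

theorem measurable_snoc {K : ℕ} (n : ℕ) :
    Measurable fun p : (Fin n → Fin K × ℝ) × (Fin K × ℝ) =>
      (Fin.snoc p.1 p.2 : Fin (n + 1) → Fin K × ℝ) := by
  refine measurable_pi_lambda _ fun i => ?_
  refine Fin.lastCases ?_ (fun j => ?_) i
  · simpa using measurable_snd
  · simpa [Function.comp_def] using
      (measurable_pi_apply (X := fun _ : Fin n => Fin K × ℝ) j).comp measurable_fst

theorem snoc_history {K : ℕ} (n : ℕ) (ω : Trajectory K) :
    (Fin.snoc (history n ω) (ω n) : Fin (n + 1) → Fin K × ℝ) = history (n + 1) ω := by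
  ext1 i
  refine Fin.lastCases ?_ (fun j => ?_) i <;> simp [history]

theorem lintegral_law_history_succ {K : ℕ} (ν : Fin K → Measure ℝ)
    [∀ a, IsProbabilityMeasure (ν a)] (alg : Strategy K) (n : ℕ)
    {f : (Fin (n + 1) → Fin K × ℝ) → ENNReal} (hf : Measurable f) :
    ∫⁻ ω, f (history (n + 1) ω) ∂(law ν alg) =
      ∫⁻ ω, ∫⁻ y, f (Fin.snoc (history n ω) y)
        ∂(pullKernel ν (alg.sample n (history n ω))) ∂(law ν alg) := by
  have hg := hf.comp (measurable_snoc (K := K) n)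
  simp_rw [← snoc_history]
  cases n with
  -- The first pair comes from the initial law rather than from `stepKernel`, hence the separate
  -- case.
  | zero =>
    have h0 : ∀ ω : Trajectory K, history 0 ω = Fin.elim0 := fun ω => Subsingleton.elim _ _
    have hg' : Measurable fun y : Fin K × ℝ =>
        f (Fin.snoc (α := fun _ => Fin K × ℝ) Fin.elim0 y) :=
      hg.comp measurable_prodMk_left
    simp_rw [h0]
    rw [lintegral_const, measure_univ, mul_one, ← law_map_zero ν alg,
      lintegral_map hg' (by fun_prop)]
  | succ n =>
    have key := Kernel.map_frestrictLe_trajMeasure_compProd_eq_map_trajMeasure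
      (X := fun _ => Fin K × ℝ) (μ₀ := pullKernel ν (alg.sample 0 Fin.elim0))
      (κ := stepKernel ν alg) (a := n)
    have hG : Measurable fun p : ((i : Finset.Iic n) → Fin K × ℝ) × (Fin K × ℝ) =>
        f (Fin.snoc (α := fun _ => Fin K × ℝ) (toHistory n p.1) p.2) :=
      hg.comp (((measurable_toHistory n).comp measurable_fst).prodMk measurable_snd)
    have h1 := lintegral_map (μ := law ν alg) hG
      (g := fun x => (Preorder.frestrictLe (π := fun _ => Fin K × ℝ) n x, x (n + 1)))
      (by fun_prop)
    rw [law, ← key, Measure.lintegral_compProd hG,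
      lintegral_map hG.lintegral_kernel_prod_right' (by fun_prop)] at h1
    exact h1.symm

/-- If the reward laws of two instances satisfy a Hölder-type comparison with
constant `c`, then the laws of the first `n` rounds compare with constant `c ^ n`. -/
theorem lintegral_law_history_le {K : ℕ} (ν ν' : Fin K → Measure ℝ)
    [∀ a, IsProbabilityMeasure (ν a)] [∀ a, IsProbabilityMeasure (ν' a)] (alg : Strategy K)
    {q : ℝ} (hq : 0 < q) (c : ENNReal)
    (h : ∀ (a : Fin K) (f : ℝ → ENNReal), Measurable f →
      ∫⁻ x, f x ∂(ν a) ≤ c * (∫⁻ x, f x ^ q ∂(ν' a)) ^ (1 / q))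
    (n : ℕ) {f : (Fin n → Fin K × ℝ) → ENNReal} (hf : Measurable f) :
    ∫⁻ ω, f (history n ω) ∂(law ν alg) ≤
      c ^ n * (∫⁻ ω, f (history n ω) ^ q ∂(law ν' alg)) ^ (1 / q) := by
  induction n with
  | zero =>
    have h0 : ∀ ω : Trajectory K, history 0 ω = Fin.elim0 := fun ω => Subsingleton.elim _ _
    simp_rw [h0]
    simp [← ENNReal.rpow_mul, hq.ne']
  | succ n ih =>
    have hg := hf.comp (measurable_snoc (K := K) n)
    have hsec : ∀ h : Fin n → Fin K × ℝ, Measurable fun y : Fin K × ℝ =>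
        f (Fin.snoc (α := fun _ => Fin K × ℝ) h y) := fun h => hg.comp measurable_prodMk_left
    have hinner : Measurable fun h : Fin n → Fin K × ℝ =>
        ∫⁻ y, f (Fin.snoc (α := fun _ => Fin K × ℝ) h y) ^ q
          ∂(pullKernel ν' (alg.sample n h)) :=
      Measurable.lintegral_kernel_prod_right'
        (κ := (pullKernel ν').comap (alg.sample n) (alg.measurable_sample n))
        (hg.pow_const q)
    rw [lintegral_law_history_succ ν alg n hf,
      lintegral_law_history_succ ν' alg n (hf.pow_const q)]
    -- Given the past, both instances pull the same arm, so only the reward laws are compared.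
    have hstep : ∀ ω : Trajectory K,
        ∫⁻ y, f (Fin.snoc (history n ω) y) ∂(pullKernel ν (alg.sample n (history n ω))) ≤
          c * (∫⁻ y, f (Fin.snoc (history n ω) y) ^ q
            ∂(pullKernel ν' (alg.sample n (history n ω)))) ^ (1 / q) := fun ω => by
      rw [lintegral_pullKernel _ _ (hsec _), lintegral_pullKernel _ _ ((hsec _).pow_const q)]
      exact h _ _ ((hsec _).comp measurable_prodMk_left)
    refine (lintegral_mono hstep).trans ?_
    have hmeas := (hinner.pow_const (1 / q)).comp (measurable_history n)
    simp only [Function.comp_def] at hmeas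
    rw [lintegral_const_mul _ hmeas, pow_succ', mul_assoc]
    gcongr
    -- The induction hypothesis is used for the `1 / q`-th power of the inner integral; raising it
    -- to the power `q` cancels the root.
    refine (ih (hinner.pow_const (1 / q))).trans_eq ?_
    simp_rw [← ENNReal.rpow_mul, one_div_mul_cancel hq.ne', ENNReal.rpow_one]

theorem law_gaussianInstance_le {K : ℕ} {p q : ℝ} (hpq : p.HolderConjugate q) (m : Fin K → ℝ)
    (d : ℝ) (alg : Strategy K) (n : ℕ) {B : Set (Trajectory K)}
    (hB : MeasurableSet[historyFiltration K n] B) :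
    (law (gaussianInstance m) alg).real B ≤
      Real.exp (n * ((p - 1) * d ^ 2 / 2)) *
        (law (gaussianInstance fun a => m a - d) alg).real B ^ (1 / q) := by
  obtain ⟨S, hS, rfl⟩ := hB
  have hq : 0 < q := hpq.symm.pos
  have h := lintegral_law_history_le (gaussianInstance m) (gaussianInstance fun a => m a - d) alg
    hq (ENNReal.ofReal (Real.exp ((p - 1) * d ^ 2 / 2)))
    (fun a f hf => by
      simpa [gaussianInstance] using lintegral_gaussianReal_le_rpow hpq (m a) (m a - d) hf)
    n (f := S.indicator 1) (measurable_one.indicator hS)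
  have hi : ∀ ω : Trajectory K, S.indicator (1 : (Fin n → Fin K × ℝ) → ENNReal) (history n ω) =
      (history n ⁻¹' S).indicator 1 ω := fun ω => rfl
  have hi' : ∀ ω : Trajectory K, S.indicator (1 : (Fin n → Fin K × ℝ) → ENNReal) (history n ω) ^ q =
      (history n ⁻¹' S).indicator 1 ω := fun ω => by
    by_cases hω : history n ω ∈ S <;> simp [hω, hq]
  simp_rw [hi'] at h
  simp_rw [hi] at h
  rw [lintegral_indicator_one (measurable_history n hS),
    lintegral_indicator_one (measurable_history n hS)] at h
  have hfin : ENNReal.ofReal (Real.exp ((p - 1) * d ^ 2 / 2)) ^ n *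
      (law (gaussianInstance fun a => m a - d) alg) (history n ⁻¹' S) ^ (1 / q) ≠ ⊤ :=
    ENNReal.mul_ne_top (by finiteness)
      (ENNReal.rpow_ne_top_of_nonneg (by positivity) (measure_ne_top _ _))
  have h' := ENNReal.toReal_mono hfin h
  rw [ENNReal.toReal_mul, ENNReal.toReal_pow, ENNReal.toReal_ofReal (Real.exp_pos _).le,
    ← ENNReal.toReal_rpow, ← Real.exp_nat_mul] at h'
  exact h'


/-! ### Stopping events and the PAC property -/

theorem measurableSet_le_and_recommend {K : ℕ} (alg : Strategy K) (n : ℕ)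
    (A : Set (Option (Fin K))) :
    MeasurableSet[historyFiltration K n] {ω | alg.τ ω ≤ n ∧ alg.recommend ω ∈ A} := by
  have h : {ω | alg.τ ω ≤ n ∧ alg.recommend ω ∈ A} =
      ⋃ t ∈ Set.Iic n, ⋃ r ∈ A, {ω | alg.τ ω = (t : ℕ) ∧ alg.recommend ω = r} := by
    ext ω
    simp only [Set.mem_ofPred_eq, Set.mem_iUnion, Set.mem_Iic, exists_prop]
    constructor
    · rintro ⟨h1, h2⟩
      obtain ⟨t, ht⟩ := ENat.ne_top_iff_exists.1 (ne_top_of_le_ne_top (ENat.natCast_ne_top n) h1)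
      exact ⟨t, by rw [← ht] at h1; exact_mod_cast h1, _, h2, ht.symm, rfl⟩
    · rintro ⟨t, ht, r, hr, h1, rfl⟩
      exact ⟨by rw [h1]; exact_mod_cast ht, hr⟩
  rw [h]
  exact MeasurableSet.biUnion (Set.to_countable _) fun t ht =>
    MeasurableSet.biUnion (Set.to_countable _) fun r _ =>
      (historyFiltration K).mono ht _ (alg.measurableSet_recommend t r)

/-- Markov's inequality; `n + 1` is allowed because `τ` is integer-valued. -/
theorem ofReal_mul_le_expectedTime {K : ℕ} (ν : Fin K → Measure ℝ)
    [∀ a, IsProbabilityMeasure (ν a)] (alg : Strategy K) (n : ℕ) {T : ℝ} (hT : T ≤ n + 1)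
    (hT0 : 0 ≤ T) :
    ENNReal.ofReal (T * (law ν alg).real {ω | (n : ℕ∞) < alg.τ ω}) ≤ expectedTime ν alg := by
  have hm : MeasurableSet {ω | (n : ℕ∞) < alg.τ ω} := by
    have h := (historyFiltration K).le n _ (alg.isStoppingTime n)
    have h' : {ω | (n : ℕ∞) < alg.τ ω} = {ω | alg.τ ω ≤ (n : ℕ∞)}ᶜ := by ext; simp
    rw [h']
    exact h.compl
  rw [ENNReal.ofReal_mul hT0, ofReal_measureReal, ← lintegral_indicator_const hm]
  refine lintegral_mono fun ω => ?_
  by_cases hω : (n : ℕ∞) < alg.τ ω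
  · rw [Set.indicator_of_mem (show ω ∈ {ω | (n : ℕ∞) < alg.τ ω} from hω)]
    have h1 : ((n + 1 : ℕ) : ℕ∞) ≤ alg.τ ω := by
      simpa using Order.add_one_le_of_lt hω
    have h2 : (((n + 1 : ℕ) : ℕ∞) : ENNReal) ≤ (alg.τ ω : ENNReal) := by exact_mod_cast h1
    refine le_trans ?_ h2
    rw [ENat.toENNReal_coe]
    exact ENNReal.ofReal_le_of_le_toReal (by rw [ENNReal.toReal_natCast]; exact_mod_cast hT)
  · rw [Set.indicator_of_notMem (show ω ∉ {ω | (n : ℕ∞) < alg.τ ω} from hω)]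
    exact zero_le

/-- On a positive instance, stopping with a correct answer before time `n` is an event of
probability at most `δ` under any negative instance. -/
theorem IsPAC.law_real_le_of_isNegative {K : ℕ} {μ₀ δ : ℝ} {alg : Strategy K}
    (halg : IsPAC μ₀ δ alg) (ν ν' : Fin K → Measure ℝ) [∀ a, IsProbabilityMeasure (ν' a)]
    (hsub : IsSubGaussianInstance ν') (hpos : IsPositive μ₀ ν) (hneg : IsNegative μ₀ ν') (n : ℕ) :
    (law ν' alg).real {ω | alg.τ ω ≤ n ∧ alg.recommend ω ∈ correctAnswers μ₀ ν} ≤ δ := by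
  have h := halg ν' hsub (Or.inr hneg)
  have hB := (historyFiltration K).le n _
    (measurableSet_le_and_recommend alg n (correctAnswers μ₀ ν))
  have hdisj : Disjoint {ω | alg.τ ω ≠ ⊤ ∧ alg.recommend ω ∈ correctAnswers μ₀ ν'}
      {ω | alg.τ ω ≤ n ∧ alg.recommend ω ∈ correctAnswers μ₀ ν} := by
    rw [Set.disjoint_left]
    rintro ω ⟨-, h1⟩ ⟨-, h2⟩
    rcases h1 with ⟨⟨a, ha⟩, -⟩ | ⟨-, h1⟩
    · exact (hneg a).not_gt ha
    rcases h2 with ⟨-, a, h2, -⟩ | ⟨h2, -⟩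
    · simp [h1] at h2
    · obtain ⟨a, ha⟩ := hpos
      exact (h2 a).not_gt ha
  have hu := measureReal_union (μ := law ν' alg) hdisj hB
  have h1 : (law ν' alg).real _ ≤ 1 := measureReal_le_one
    (s := {ω | alg.τ ω ≠ ⊤ ∧ alg.recommend ω ∈ correctAnswers μ₀ ν'} ∪
      {ω | alg.τ ω ≤ n ∧ alg.recommend ω ∈ correctAnswers μ₀ ν})
  linarith

/-- Lower bound on the probability of sampling for more than `n` rounds, for every Hölder
exponent `κ`. -/
theorem IsPAC.le_law_real_lt_τ {K : ℕ} {μ₀ δ : ℝ} {alg : Strategy K}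
    (halg : IsPAC μ₀ δ alg) {m : Fin K → ℝ} (hpos : ∃ a, μ₀ < m a) {d : ℝ}
    (hd : ∀ a, m a - d < μ₀) {κ : ℝ} (hκ : 0 < κ) (hκ1 : κ < 1) (n : ℕ) :
    1 - δ - Real.exp (n * ((1 / κ - 1) * d ^ 2 / 2)) * δ ^ (1 - κ) ≤
      (law (gaussianInstance m) alg).real {ω | (n : ℕ∞) < alg.τ ω} := by
  -- With this parametrisation the power `1 / q` of the shifted probability is `1 - κ`.
  have hpq : (1 / κ).HolderConjugate (1 / (1 - κ)) := by
    rw [Real.holderConjugate_iff]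
    exact ⟨(one_lt_div hκ).2 hκ1, by simp⟩
  have hpos' : IsPositive μ₀ (gaussianInstance m) := by
    obtain ⟨a, ha⟩ := hpos
    exact ⟨a, by rwa [mean_gaussianInstance]⟩
  have hneg : IsNegative μ₀ (gaussianInstance fun a => m a - d) := fun a => by
    rw [mean_gaussianInstance]; exact hd a
  have h1 := halg (gaussianInstance m) (isSubGaussianInstance_gaussianInstance m) (Or.inl hpos')
  have h2 := law_gaussianInstance_le hpq m d alg n
    (measurableSet_le_and_recommend alg n (correctAnswers μ₀ (gaussianInstance m)))
  have h3 := halg.law_real_le_of_isNegative (gaussianInstance m) _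
    (isSubGaussianInstance_gaussianInstance _) hpos' hneg n
  have h4 := Real.rpow_le_rpow measureReal_nonneg h3 (sub_pos.2 hκ1).le
  rw [one_div_one_div] at h2
  have h5 := mul_le_mul_of_nonneg_left h4
    (Real.exp_pos (n * ((1 / κ - 1) * d ^ 2 / 2))).le
  have h6 : (law (gaussianInstance m) alg).real
      {ω | alg.τ ω ≠ ⊤ ∧ alg.recommend ω ∈ correctAnswers μ₀ (gaussianInstance m)} ≤
      (law (gaussianInstance m) alg).real
        ({ω | alg.τ ω ≤ n ∧ alg.recommend ω ∈ correctAnswers μ₀ (gaussianInstance m)} ∪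
          {ω | (n : ℕ∞) < alg.τ ω}) := by
    refine measureReal_mono fun ω hω => ?_
    rcases le_or_gt (alg.τ ω) n with h | h
    · exact Or.inl ⟨h, hω.2⟩
    · exact Or.inr h
  have h7 := h6.trans (measureReal_union_le _ _)
  linarith

/-! ### Choice of constants and conclusion -/

theorem exists_holder_exponent {δ₀ : ℝ} (hδ₀ : 0 < δ₀) (hδ₀' : δ₀ < 1 / 2) :
    ∃ κ : ℝ, 0 < κ ∧ κ < 1 ∧ 0 < 1 - 2 * κ ∧ δ₀ ^ (1 - 2 * κ) = 1 / 2 := by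
  have h0 : Real.log δ₀ < Real.log (1 / 2) := Real.log_lt_log hδ₀ hδ₀'
  have h1 : Real.log (1 / 2) < 0 := Real.log_neg (by norm_num) (by norm_num)
  have hx1 : Real.log (1 / 2) / Real.log δ₀ < 1 := by
    rw [div_lt_one_of_neg (h0.trans h1)]; exact h0
  have hx0 : 0 < Real.log (1 / 2) / Real.log δ₀ := div_pos_of_neg_of_neg h1 (h0.trans h1)
  -- Solves `(1 - 2 * κ) * log δ₀ = log (1 / 2)`; `δ₀ < 1 / 2` is what makes `κ` positive.
  refine ⟨(1 - Real.log (1 / 2) / Real.log δ₀) / 2, by linarith, by linarith, by linarith, ?_⟩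
  rw [Real.rpow_def_of_pos hδ₀]
  have : Real.log δ₀ * (1 - 2 * ((1 - Real.log (1 / 2) / Real.log δ₀) / 2)) =
      Real.log (1 / 2) := by
    field_simp [(h0.trans h1).ne]
    ring
  rw [this, Real.exp_log (by norm_num)]

end OneIdentification

theorem mainTheorem4 (δ₀ : ℝ) (hδ₀ : 0 < δ₀) (hδ₀' : δ₀ < 1 / 2) :
    ∃ c : ℝ, 0 < c ∧
      ∀ (K : ℕ) [NeZero K] (μ₀ : ℝ) (μ : Fin K → ℝ),
        μ₀ ∈ Set.Icc (0 : ℝ) 1 → (∀ a, μ a ∈ Set.Icc (0 : ℝ) 1) → Antitone μ → μ₀ < μ 0 →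
        ∀ (σ : Equiv.Perm (Fin K)) (δ : ℝ), 0 < δ → δ ≤ δ₀ →
        ∀ alg : OneIdentification.Strategy K, OneIdentification.IsPAC μ₀ δ alg →
          ENNReal.ofReal (c * (Real.log (1 / δ) / |μ₀ - μ 0| ^ 2)) ≤
            OneIdentification.expectedTime
              (OneIdentification.gaussianInstance fun a => μ (σ a)) alg := by
  obtain ⟨κ, hκ, hκ1, hκ2, hκδ⟩ := OneIdentification.exists_holder_exponent hδ₀ hδ₀'
  have hp : 0 < 1 / κ - 1 := sub_pos.2 ((one_lt_div hκ).2 hκ1)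
  refine ⟨κ / (2 * (1 / κ - 1)) * (1 / 2 - δ₀), mul_pos (by positivity) (by linarith), ?_⟩
  intro K _ μ₀ μ _ _ hanti hμ σ δ hδ hδδ₀ alg halg
  have hΔ : 0 < μ 0 - μ₀ := sub_pos.2 hμ
  have hlog : 0 < Real.log (1 / δ) := Real.log_pos ((one_lt_div hδ).2 (by linarith))
  -- Chosen so that the Hölder factor at time `T` is exactly `δ ^ (-κ)`.
  set T : ℝ := κ / (2 * (1 / κ - 1)) * (Real.log (1 / δ) / (μ 0 - μ₀) ^ 2) with hT
  have hT0 : 0 ≤ T := by positivity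
  have hfloor := Nat.floor_le hT0
  -- Any shift above the gap would do; twice the gap puts all means at least one gap below `μ₀`.
  have hτ := halg.le_law_real_lt_τ (m := fun a => μ (σ a)) (d := 2 * (μ 0 - μ₀))
    ⟨σ.symm 0, by simpa using hμ⟩
    (fun a => by have := hanti (Fin.zero_le (σ a)); linarith) hκ hκ1 ⌊T⌋₊
  have hexp : Real.exp (⌊T⌋₊ * ((1 / κ - 1) * (2 * (μ 0 - μ₀)) ^ 2 / 2)) * δ ^ (1 - κ) ≤ 1 / 2 := by
    calc _ ≤ Real.exp (T * ((1 / κ - 1) * (2 * (μ 0 - μ₀)) ^ 2 / 2)) * δ ^ (1 - κ) := by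
          gcongr
      _ = δ ^ (1 - 2 * κ) := by
          have : T * ((1 / κ - 1) * (2 * (μ 0 - μ₀)) ^ 2 / 2) = Real.log δ * (-κ) := by
            rw [hT, one_div δ, Real.log_inv]
            generalize 1 / κ - 1 = w at hp
            field_simp
          rw [this, ← Real.rpow_def_of_pos hδ, ← Real.rpow_add hδ]
          congr 1
          ring
      _ ≤ δ₀ ^ (1 - 2 * κ) := Real.rpow_le_rpow hδ.le hδδ₀ hκ2.le
      _ = 1 / 2 := hκδ
  refine le_trans (ENNReal.ofReal_le_ofReal ?_)
    (OneIdentification.ofReal_mul_le_expectedTime _ alg ⌊T⌋₊ (Nat.lt_floor_add_one T).le hT0)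
  calc _ = T * (1 / 2 - δ₀) := by
        rw [hT, abs_sub_comm, abs_of_pos hΔ]
        ring
    _ ≤ _ := mul_le_mul_of_nonneg_left (by linarith) hT0
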